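/- Let $K$ be an infinite field, $n\ge 0$, and let $E=K\langle e_1,\dots,e_n\rangle$ be the exterior algebra on the $K$-vector space with basis $e_1,\dots,e_n$, graded by $\deg e_i=1$. For $A=\{i_1<\dots<i_r\}\subseteq\{1,\dots,n\}$ put $e_A=e_{i_1}\wedge\dots\wedge e_{i_r}$; these are the monomials of $E$. *Annihilator numbers.* For a finitely generated graded $E$-module $M$ and $v\in E_1$ let $H^j(M,v)$ be the homology in degree $j$ of the complex $\cdots\to M_{j-1}\xrightarrow{\cdot v}M_j\xrightarrow{\cdot v}M_{j+1}\to\cdots$. For a basis $v_1,\dots,v_n$ of $E_1$, $1\le i\le n$ and $j\in\mathbb Z$ put $$\alpha_{i,j}(v_1,\dots,v_n;M)=\dim_K H^j\big(M/(v_1,\dots,v_{i-1})M,\;v_i\big).$$ *Generic initial ideal.* Let $<_{\mathrm{rlex}}$ be the (degree) reverse lexicographic order with respect to $e_1<\dots<e_n$: $e_A<_{\mathrm{rlex}}e_B$ iff $|A|<|B|$, or $|A|=|B|$, $A\neq B$ and the smallest element of the symmetric difference of $A$ and $B$ lies in $A$. For an ideal $J$ let $\mathrm{in}_{\mathrm{rlex}}(J)$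 be the ideal generated by the largest monomials occurring in the nonzero elements of $J$. A matrix $\varphi\in GL_n(K)$ acts on $E$ as the algebra automorphism with $e_j\mapsto\sum_{i}\varphi_{i,j}e_i$. A subset of $GL_n(K)$ is Zariski-open if it is the set of $\gamma\in GL_n(K)$ at which at least one member of some family of polynomials in the matrix entries does not vanish. An ideal $I$ is called the generic initial ideal of $J$, written $I=\mathrm{gin}_{\mathrm{rlex}}(J)$, if $\mathrm{in}_{\mathrm{rlex}}(\varphi(J))=I$ for all $\varphi$ in some nonempty Zariski-open subset of $GL_n(K)$. **Theorem.** Let $J\subseteq E$ be a graded ideal. Then $\mathrm{gin}_{\mathrm{rlex}}(J)$ is well defined, i.e. there is exactly one ideal $I$ as above, and there exists a nonempty Zariski-open set $U\subseteq GL_n(K)$ such that, for all $\gamma=(\gamma_{k,l})\in U$, all $1\le i\le n$ and all $j\in\mathbb Z$, $$\alpha_{i,j}(\gamma(e_1,\dots,e_n);E/J)=\alpha_{i,j}(e_1,\dots,e_n;E/\mathrm{gin}_{\mathrm{rlex}}(J)),$$ where $\gamma(e_1,\dots,e_n)=(\gamma_{1,1}e_1+\dots+\gamma_{n,1}e_n,\;\dots,\;\gamma_{1,n}e_1+\dots+\gamma_{n,n}e_n)$.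 -/

import Mathlib

open scoped Matrix

namespace ExtAnn

noncomputable section

/-- The exterior algebra `E = K⟨e₁, …, eₙ⟩`. -/
abbrev E (K : Type*) [Field K] (n : ℕ) : Type _ :=
  ExteriorAlgebra K (Fin n → K)

/-- The generator `e_k` of `E`. -/
def gen (K : Type*) [Field K] {n : ℕ} (k : Fin n) : E K n :=
  ExteriorAlgebra.ι K (Pi.single k (1 : K))

/-- The monomial `e_A = e_{i₁} ∧ ⋯ ∧ e_{i_r}` for `A = {i₁ < ⋯ < i_r}`; the monomials form a
`K`-basis of `E`. -/
def monomialBasis (K : Type*) [Field K] (n : ℕ) : Module.Basis (Finset (Fin n)) K (E K n) :=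
  (Pi.basisFun K (Fin n)).ExteriorAlgebra

/-- The (degree) reverse lexicographic order with respect to `e₁ < ⋯ < eₙ`: for sets of the same
size, `e_A < e_B` iff the smallest element of the symmetric difference of `A` and `B` lies in
`A`. -/
def RlexLT {n : ℕ} (A B : Finset (Fin n)) : Prop :=
  A.card < B.card ∨
    (A.card = B.card ∧ ∃ i, i ∈ A ∧ i ∉ B ∧ ∀ k, k < i → (k ∈ A ↔ k ∈ B))

/-- `e_A` is the initial (largest) monomial of `f`. -/
def IsInitialMonomial {K : Type*} [Field K] {n : ℕ} (f : E K n) (A : Finset (Fin n)) : Prop :=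
  (monomialBasis K n).repr f A ≠ 0 ∧
    ∀ B, (monomialBasis K n).repr f B ≠ 0 → B ≠ A → RlexLT B A

/-- The initial ideal of `J`, generated by the initial monomials of the nonzero elements of `J`.
(`Ideal` means left ideal; in `E`, every graded left ideal and every left ideal generated by
monomials is two-sided.) -/
def initialIdeal {K : Type*} [Field K] {n : ℕ} (J : Ideal (E K n)) : Ideal (E K n) :=
  Ideal.span {m | ∃ f ∈ J, ∃ A, IsInitialMonomial f A ∧ m = monomialBasis K n A}

/-- A subset of `GL_n(K)` is Zariski-open if it is the non-vanishing locus in `GL_n(K)` of a set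
of polynomials in the matrix entries. -/
def IsZariskiOpen {K : Type*} [Field K] {n : ℕ} (U : Set (GL (Fin n) K)) : Prop :=
  ∃ S : Set (MvPolynomial (Fin n × Fin n) K), ∀ γ : GL (Fin n) K,
    γ ∈ U ↔ ∃ p ∈ S, MvPolynomial.eval (fun ij => γ.val ij.1 ij.2) p ≠ 0

/-- The automorphism of `E` induced by `φ ∈ GL_n(K)`, i.e. `e_j ↦ ∑ i, φ i j • e_i`. -/
def action {K : Type*} [Field K] {n : ℕ} (φ : GL (Fin n) K) : E K n →ₐ[K] E K n :=
  ExteriorAlgebra.map (Matrix.toLin' φ.val)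

/-- `I` is the generic initial ideal of `J`: it is the initial ideal of `φ(J)` for all `φ` in some
nonempty Zariski-open subset of `GL_n(K)`. -/
def IsGenericInitialIdeal {K : Type*} [Field K] {n : ℕ} (J I : Ideal (E K n)) : Prop :=
  ∃ U : Set (GL (Fin n) K), IsZariskiOpen U ∧ U.Nonempty ∧
    ∀ φ ∈ U, initialIdeal (J.map (action φ)) = I

open Classical in
/-- The generic initial ideal of `J` with respect to the reverse lexicographic order. -/
def gin {K : Type*} [Field K] {n : ℕ} (J : Ideal (E K n)) : Ideal (E K n) :=
  if h : ∃ I, IsGenericInitialIdeal J I then h.choose else ⊥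

section Homology

variable {K : Type*} [Field K] {n : ℕ} {M : Type*} [AddCommGroup M] [Module (E K n) M]
  [Module K M] [IsScalarTower K (E K n) M]

/-- The grading induced on the quotient `M / N` by a grading `(M_j)` of `M`. -/
def quotGrading (ℳ : ℤ → Submodule K M) (N : Submodule (E K n) M) :
    ℤ → Submodule K (M ⧸ N) :=
  fun j => (ℳ j).map (N.mkQ.restrictScalars K)

/-- Multiplication by `v ∈ E` on `M`, as a `K`-linear map. -/
def mulBy (M : Type*) [AddCommGroup M] [Module (E K n) M] [Module K M]
    [IsScalarTower K (E K n) M] (v : E K n) : M →ₗ[K] M :=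
  Algebra.lsmul K K M v

/-- Cocycles in degree `j` of the complex `(M, v) : ⋯ → M_{j-1} → M_j → M_{j+1} → ⋯` with
differential the multiplication by `v`. -/
def cocycles (ℳ : ℤ → Submodule K M) (v : E K n) (j : ℤ) : Submodule K M :=
  ℳ j ⊓ LinearMap.ker (mulBy M v)

/-- Coboundaries in degree `j` of the complex `(M, v)`. -/
def coboundaries (ℳ : ℤ → Submodule K M) (v : E K n) (j : ℤ) : Submodule K M :=
  (ℳ (j - 1)).map (mulBy M v)

/-- The homology `H^j(M, v)`. -/
abbrev H (ℳ : ℤ → Submodule K M) (v : E K n) (j : ℤ) : Type _ :=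
  cocycles ℳ v j ⧸ (coboundaries ℳ v j).comap (cocycles ℳ v j).subtype

/-- The submodule `(v₁, …, v_{i-1}) M`. -/
def seqSubmodule (M : Type*) [AddCommGroup M] [Module (E K n) M]
    (v : Fin n → E K n) (i : Fin n) : Submodule (E K n) M :=
  Submodule.span (E K n) {x | ∃ k, k < i ∧ ∃ m : M, x = v k • m}

/-- The exterior annihilator number
`α_{i,j}(v₁, …, vₙ; M) = dim_K H^j(M / (v₁, …, v_{i-1}) M, v_i)`. -/
def annihilatorNumber (ℳ : ℤ → Submodule K M) (v : Fin n → E K n) (i : Fin n) (j : ℤ) : ℕ :=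
  Module.finrank K (H (quotGrading ℳ (seqSubmodule M v i)) (v i) j)

end Homology

/-- The graded components `E_j`, `j ∈ ℤ`, of the exterior algebra. -/
def extGrading (K : Type*) [Field K] (n : ℕ) : ℤ → Submodule K (E K n)
  | Int.ofNat j => ⋀[K]^j (Fin n → K)
  | Int.negSucc _ => ⊥

/-- `α_{i,j}(v₁, …, vₙ; E/J)`. -/
def alpha {K : Type*} [Field K] {n : ℕ} (v : Fin n → E K n) (J : Ideal (E K n))
    (i : Fin n) (j : ℤ) : ℕ :=
  annihilatorNumber (M := E K n ⧸ J) (quotGrading (extGrading K n) J) v i j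

/-- The sequence `γ(e₁, …, eₙ)`, whose `i`-th member is `γ_{1,i} e₁ + ⋯ + γ_{n,i} eₙ`. -/
def transformedSeq {K : Type*} [Field K] {n : ℕ} (γ : GL (Fin n) K) : Fin n → E K n :=
  fun i => ∑ k, γ.val k i • gen K k

end

end ExtAnn

/-!
Two facts make the statement true.

For *every* graded ideal `J`, the sequence `e₁, …, eₙ` has the same annihilator numbers on `E/J` and
on `E/in(J)` (`alpha_gen_initialIdeal`). By rank-nullity, an annihilator number is an alternating sum
of dimensions of graded components of `J + (v₁, …, v_{i-1})` and `J + (v₁, …, v_i)` (`alpha_add`), so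
it suffices to compare Hilbert functions. In the reverse lexicographic order the monomials divisible
by one of `e₁, …, e_i` are, degree by degree, smaller than all the others
(`RlexLT.of_mem_of_forall_notMem`); hence the initial monomials of `J + (e₁, …, e_i)` are those of
`J` together with the monomials divisible by one of `e₁, …, e_i` (`initSet_sup_span_gen`). The same
description applies to `in(J)`, which has the same initial monomials as `J`, and the dimension of a
subspace is the number of its initial monomials (`finrank_eq_ncard_initSet`).

The initial monomials of `φ(J)` are determined by the ranks of the projections of `φ(J)` to sets of
coordinates (`mem_initSet_iff`). These ranks are lower semicontinuous in `φ`
(`exists_evalGL_ne_zero_finrank_range_le`) and there are finitely many of them, so they are all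
maximal on a nonempty Zariski-open set; this gives the existence of the generic initial ideal
(`exists_isGenericInitialIdeal`). It is unique because nonempty Zariski-open sets meet when `K` is
infinite.

The change of coordinates `γ⁻¹` carries `γ(e₁, …, eₙ)` to `e₁, …, eₙ` and `J` to `γ⁻¹(J)`
(`alpha_transformedSeq`), so the required open set consists of the `γ` for which `γ⁻¹` lies in an
open set that defines the generic initial ideal.
-/

open scoped Matrix

namespace ExtAnn

noncomputable section

/-! ### Multiplication of monomials and graded components -/

section Monomials

variable {K : Type*} [Field K] {n : ℕ}

@[elab_as_elim]
theorem monomial_induction {p : E K n → Prop} (f : E K n) (zero : p 0)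
    (add : ∀ f g, p f → p g → p (f + g)) (smul : ∀ (a : K) f, p f → p (a • f))
    (basis : ∀ A, p (monomialBasis K n A)) : p f := by
  refine Submodule.span_induction (p := fun x _ => p x) ?_ zero (fun f g _ _ => add f g)
    (fun a f _ => smul a f) ((monomialBasis K n).mem_span f)
  rintro _ ⟨A, rfl⟩
  exact basis A

theorem gen_eq_monomialBasis (k : Fin n) : gen K k = monomialBasis K n {k} := by
  have h : ({k} : Finset (Fin n)).card = 1 := Finset.card_singleton k
  rw [monomialBasis, ExteriorAlgebra.basis_apply_ofCard _ h, gen, ExteriorAlgebra.ιMulti_family,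
    ExteriorAlgebra.ιMulti_succ_apply, ExteriorAlgebra.ιMulti_zero_apply, mul_one]
  congr 1
  simp only [Function.comp, Pi.basisFun_apply]
  congr 1
  have := (Set.powersetCard.mem_range_ofFinEmbEquiv_symm_iff_mem
    (Set.powersetCard.ofCard h) (Set.powersetCard.ofFinEmbEquiv.symm
      (Set.powersetCard.ofCard h) 0)).1 ⟨0, rfl⟩
  exact (Finset.mem_singleton.1 this).symm

theorem gen_mul_monomialBasis_of_mem {k : Fin n} {A : Finset (Fin n)} (h : k ∈ A) :
    gen K k * monomialBasis K n A = 0 := by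
  rw [gen_eq_monomialBasis]
  exact ExteriorAlgebra.basis_mul_of_not_disjoint (Pi.basisFun K (Fin n))
    (Set.powersetCard.ofCard (Finset.card_singleton k)) (Set.powersetCard.ofCard (rfl : A.card = _))
    (by simpa [Set.powersetCard.ofCard] using h)

theorem gen_mul_monomialBasis_of_notMem {k : Fin n} {A : Finset (Fin n)} (h : k ∉ A) :
    ∃ ε : K, ε ≠ 0 ∧
      gen K k * monomialBasis K n A = ε • monomialBasis K n (insert k A) := by
  rw [gen_eq_monomialBasis]
  have hd : Disjoint (Set.powersetCard.ofCard (Finset.card_singleton k)).val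
    (Set.powersetCard.ofCard (rfl : A.card = _)).val := by
      simpa [Set.powersetCard.ofCard] using h
  have := ExteriorAlgebra.basis_mul_of_disjoint (Pi.basisFun K (Fin n))
    (Set.powersetCard.ofCard (Finset.card_singleton k)) (Set.powersetCard.ofCard (rfl : A.card = _))
    hd
  have e : ((Set.powersetCard.disjUnion hd : Set.powersetCard (Fin n) (1 + A.card)) :
      Finset (Fin n)) = insert k A := by
    ext; simp [Set.powersetCard.disjUnion, Set.powersetCard.ofCard]
  rw [e] at this
  rcases Int.units_eq_one_or (Set.powersetCard.permOfDisjoint hd).sign with h1 | h1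
  · refine ⟨1, one_ne_zero, ?_⟩
    rw [h1] at this
    simpa [monomialBasis] using this
  · refine ⟨-1, neg_ne_zero.2 one_ne_zero, ?_⟩
    rw [h1] at this
    simpa [monomialBasis] using this

/-- The coordinates of `e_k f` are, up to signs, those of `f`, shifted by `A ↦ A ∪ {k}`. -/
theorem exists_repr_gen_mul (k : Fin n) :
    ∃ ε : Finset (Fin n) → K, (∀ A, ε A ≠ 0) ∧ ∀ (f : E K n) (C : Finset (Fin n)),
      (monomialBasis K n).repr (gen K k * f) C =
        if k ∈ C then ε C * (monomialBasis K n).repr f (C.erase k) else 0 := by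
  have H : ∀ C : Finset (Fin n), ∃ ε : K, ε ≠ 0 ∧ (k ∈ C →
      gen K k * monomialBasis K n (C.erase k) = ε • monomialBasis K n C) := by
    intro C
    by_cases hk : k ∈ C
    · obtain ⟨ε, h0, h⟩ := gen_mul_monomialBasis_of_notMem (K := K) (Finset.notMem_erase k C)
      rw [Finset.insert_erase hk] at h
      exact ⟨ε, h0, fun _ => h⟩
    · exact ⟨1, one_ne_zero, fun h => absurd h hk⟩
  choose ε h0 hε using H
  refine ⟨ε, h0, fun f C => ?_⟩
  induction f using monomial_induction with
  | zero => simp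
  | add f g hf hg =>
    rw [mul_add, map_add, map_add, Finsupp.add_apply, Finsupp.add_apply, hf, hg]
    split_ifs <;> ring
  | smul a f hf =>
    rw [mul_smul_comm, map_smul, map_smul, Finsupp.smul_apply, Finsupp.smul_apply, hf]
    split_ifs <;> simp; ring
  | basis A =>
    by_cases hA : k ∈ A
    · rw [gen_mul_monomialBasis_of_mem hA, Module.Basis.repr_self, Finsupp.single_eq_of_ne]
      · simp
      · rintro rfl; simp at hA
    · have h := hε (insert k A) (Finset.mem_insert_self k A)
      rw [Finset.erase_insert hA] at h
      rw [h, map_smul, Module.Basis.repr_self, Module.Basis.repr_self, Finsupp.smul_apply,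
        Finsupp.single_apply, Finsupp.single_apply]
      by_cases hC : insert k A = C
      · subst hC
        simp [hA]
      · by_cases hk : k ∈ C
        · have : A ≠ C.erase k := by
            rintro rfl; exact hC (Finset.insert_erase hk)
          simp [hC, this]
        · simp [hC, hk]

theorem monomialBasis_mem (A : Finset (Fin n)) :
    monomialBasis K n A ∈ ⋀[K]^A.card (Fin n → K) := by
  have := ExteriorAlgebra.basis_eq_coe_basis (Pi.basisFun K (Fin n))
    (Set.powersetCard.ofCard (rfl : A.card = _))
  change monomialBasis K n A = _ at this
  rw [this]
  exact Subtype.prop _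

/-- The projection of `E` onto its component of degree `d`. -/
def homPart (d : ℕ) : E K n →ₗ[K] E K n :=
  GradedAlgebra.proj (fun d : ℕ => ⋀[K]^d (Fin n → K)) d

theorem homPart_mem (d : ℕ) (f : E K n) : homPart d f ∈ ⋀[K]^d (Fin n → K) := by
  rw [homPart, GradedAlgebra.proj_apply]
  exact Subtype.prop _

theorem homPart_of_mem {d : ℕ} {f : E K n} (h : f ∈ ⋀[K]^d (Fin n → K)) : homPart d f = f := by
  rw [homPart, GradedAlgebra.proj_apply]
  exact DirectSum.decompose_of_mem_same (fun d : ℕ => ⋀[K]^d (Fin n → K)) h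

theorem homPart_of_mem_of_ne {d e : ℕ} {f : E K n} (h : f ∈ ⋀[K]^d (Fin n → K)) (hd : d ≠ e) :
    homPart e f = 0 := by
  rw [homPart, GradedAlgebra.proj_apply]
  exact DirectSum.decompose_of_mem_ne (fun d : ℕ => ⋀[K]^d (Fin n → K)) h hd

theorem repr_homPart (d : ℕ) (f : E K n) (A : Finset (Fin n)) :
    (monomialBasis K n).repr (homPart d f) A =
      if A.card = d then (monomialBasis K n).repr f A else 0 := by
  induction f using monomial_induction with
  | zero => simp
  | add f g hf hg =>
    rw [map_add, map_add, map_add, Finsupp.add_apply, Finsupp.add_apply, hf, hg]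
    split_ifs <;> simp
  | smul a f hf =>
    rw [map_smul, map_smul, map_smul, Finsupp.smul_apply, Finsupp.smul_apply, hf]
    split_ifs <;> simp
  | basis B =>
    by_cases hB : B.card = d
    · subst hB
      rw [homPart_of_mem (monomialBasis_mem B), Module.Basis.repr_self, Finsupp.single_apply]
      by_cases h : B = A
      · simp [h]
      · simp [h]
    · rw [homPart_of_mem_of_ne (monomialBasis_mem B) hB, Module.Basis.repr_self,
        Finsupp.single_apply]
      by_cases h : B = A
      · subst h; simp [hB]
      · simp [h]

theorem homPart_mem_ideal {J : Ideal (E K n)}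
    (hJ : J.IsHomogeneous (fun d : ℕ => ⋀[K]^d (Fin n → K))) {f : E K n} (hf : f ∈ J) (d : ℕ) :
    homPart d f ∈ J := by
  rw [homPart, GradedAlgebra.proj_apply]
  exact hJ d hf

theorem card_eq_of_mem {d : ℕ} {f : E K n} (h : f ∈ ⋀[K]^d (Fin n → K)) {A : Finset (Fin n)}
    (hA : (monomialBasis K n).repr f A ≠ 0) : A.card = d := by
  by_contra hd
  rw [← homPart_of_mem h, repr_homPart, if_neg hd] at hA
  exact hA rfl

end Monomials

/-! ### The reverse lexicographic order and initial monomials of subspaces -/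

section Order

variable {n : ℕ}

theorem RlexLT.irrefl (A : Finset (Fin n)) : ¬ RlexLT A A := by
  rintro (h | ⟨-, i, h1, h2, -⟩)
  · exact lt_irrefl _ h
  · exact h2 h1

theorem RlexLT.trans {A B C : Finset (Fin n)} (h1 : RlexLT A B) (h2 : RlexLT B C) :
    RlexLT A C := by
  rcases h1 with h1 | ⟨h1, i, hiA, hiB, hi⟩ <;> rcases h2 with h2 | ⟨h2, j, hjB, hjC, hj⟩
  · exact Or.inl (h1.trans h2)
  · exact Or.inl (h2 ▸ h1)
  · exact Or.inl (h1 ▸ h2)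
  · refine Or.inr ⟨h1.trans h2, ?_⟩
    rcases lt_trichotomy i j with h | h | h
    · exact ⟨i, hiA, fun hC => hiB ((hj i h).2 hC), fun k hk =>
        (hi k hk).trans (hj k (hk.trans h))⟩
    · subst h; exact absurd hjB hiB
    · exact ⟨j, (hi j h).2 hjB, hjC, fun k hk => (hi k (hk.trans h)).trans (hj k hk)⟩

theorem RlexLT.asymm {A B : Finset (Fin n)} (h1 : RlexLT A B) (h2 : RlexLT B A) : False :=
  RlexLT.irrefl A (h1.trans h2)

theorem RlexLT.trichotomous {A B : Finset (Fin n)} (h : A ≠ B) : RlexLT A B ∨ RlexLT B A := by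
  rcases lt_trichotomy A.card B.card with hc | hc | hc
  · exact Or.inl (Or.inl hc)
  · have hne : (symmDiff A B).Nonempty := by
      rw [Finset.nonempty_iff_ne_empty]
      intro h0
      exact h (symmDiff_eq_bot.1 h0)
    have hmin : ∀ k, k < (symmDiff A B).min' hne → (k ∈ A ↔ k ∈ B) := by
      intro k hk
      have : k ∉ symmDiff A B := fun hk' => absurd (Finset.min'_le _ k hk') (not_le.2 hk)
      rw [Finset.mem_symmDiff] at this
      tauto
    rcases Finset.mem_symmDiff.1 (Finset.min'_mem _ hne) with ⟨h1, h2⟩ | ⟨h1, h2⟩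
    · exact Or.inl (Or.inr ⟨hc, _, h1, h2, hmin⟩)
    · exact Or.inr (Or.inr ⟨hc.symm, _, h1, h2, fun k hk => (hmin k hk).symm⟩)
  · exact Or.inr (Or.inl hc)

/-- Multiplication by `e_k` respects the order on the monomials not divisible by `e_k`. -/
theorem RlexLT.insert {A B : Finset (Fin n)} {k : Fin n} (hA : k ∉ A) (hB : k ∉ B)
    (h : RlexLT A B) : RlexLT (insert k A) (insert k B) := by
  rcases h with h | ⟨h, i, hiA, hiB, hi⟩
  · left
    rw [Finset.card_insert_of_notMem hA, Finset.card_insert_of_notMem hB]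
    omega
  · right
    refine ⟨by rw [Finset.card_insert_of_notMem hA, Finset.card_insert_of_notMem hB, h],
      i, Finset.mem_insert_of_mem hiA, ?_, fun l hl => ?_⟩
    · rw [Finset.mem_insert, not_or]
      exact ⟨fun h => hA (h ▸ hiA), hiB⟩
    · rw [Finset.mem_insert, Finset.mem_insert, hi l hl]

/-- The characteristic property of the reverse lexicographic order: in each degree, the monomials
divisible by a variable from an initial segment `T` of the variables are smaller than all the
others. -/
theorem RlexLT.of_mem_of_forall_notMem {A B : Finset (Fin n)} (hc : A.card = B.card)
    {T : Set (Fin n)} (hT : IsLowerSet T) (hA : ∃ k ∈ T, k ∈ A) (hB : ¬ ∃ k ∈ T, k ∈ B) :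
    RlexLT A B := by
  have hne : A ≠ B := fun h => hB (h ▸ hA)
  obtain ⟨k, hkT, hkA⟩ := hA
  rcases RlexLT.trichotomous hne with h | h | ⟨-, j, hjB, hjA, hj⟩
  · exact h
  · omega
  · -- `j` is the smallest element distinguishing `A` and `B`, and `j ∉ T`, hence `k < j`
    have hkj : k < j := not_le.1 fun hle => hB ⟨j, hT hle hkT, hjB⟩
    exact absurd ⟨k, hkT, (hj k hkj).2 hkA⟩ hB

theorem exists_maximal_rlex (S : Set (Finset (Fin n))) (hS : S.Nonempty) :
    ∃ A ∈ S, ∀ B ∈ S, B ≠ A → RlexLT B A := by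
  have : IsTrans (Finset (Fin n)) (Function.swap RlexLT) := ⟨fun _ _ _ h1 h2 => h2.trans h1⟩
  have : Std.Irrefl (Function.swap (RlexLT (n := n))) := ⟨RlexLT.irrefl⟩
  have wf := Finite.wellFounded_of_trans_of_irrefl (Function.swap (RlexLT (n := n)))
  obtain ⟨A, hA, h⟩ := wf.has_min S hS
  exact ⟨A, hA, fun B hB hne => (RlexLT.trichotomous hne).resolve_right (h B hB)⟩

end Order

section InitialMonomials

variable {K : Type*} [Field K] {n : ℕ}

theorem exists_isInitialMonomial {f : E K n} (hf : f ≠ 0) : ∃ A, IsInitialMonomial f A := by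
  obtain ⟨A, hA, h⟩ := exists_maximal_rlex {A | (monomialBasis K n).repr f A ≠ 0} (by
    by_contra hS
    rw [Set.not_nonempty_iff_eq_empty, Set.eq_empty_iff_forall_notMem] at hS
    apply hf
    apply (monomialBasis K n).repr.injective
    ext A
    simpa using hS A)
  exact ⟨A, hA, h⟩

theorem IsInitialMonomial.repr_eq_zero {f : E K n} {A B : Finset (Fin n)}
    (h : IsInitialMonomial f A) (hAB : RlexLT A B) : (monomialBasis K n).repr f B = 0 := by
  by_contra hB
  have hne : B ≠ A := by rintro rfl; exact RlexLT.irrefl _ hAB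
  exact (h.2 B hB hne).asymm hAB

theorem isInitialMonomial_monomialBasis (A : Finset (Fin n)) :
    IsInitialMonomial (monomialBasis K n A) A := by
  refine ⟨by simp, fun B hB hne => ?_⟩
  rw [Module.Basis.repr_self, Finsupp.single_eq_of_ne hne] at hB
  exact absurd rfl hB

/-- The monomials (as subsets of the set of indices) that are the initial monomial of some element
of the subspace `V`. -/
def initSet (V : Submodule K (E K n)) : Set (Finset (Fin n)) :=
  {A | ∃ f ∈ V, IsInitialMonomial f A}

theorem initSet_mono {V W : Submodule K (E K n)} (h : V ≤ W) : initSet V ⊆ initSet W :=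
  fun _ ⟨f, hf, hA⟩ => ⟨f, h hf, hA⟩

instance : Module.Finite K (E K n) := Module.Finite.of_basis (monomialBasis K n)

/-- Elements of `V` with pairwise distinct initial monomials are linearly independent, and an
element of `V` is determined by its coordinates at the monomials in `initSet V`. -/
theorem finrank_eq_ncard_initSet (V : Submodule K (E K n)) :
    Module.finrank K V = (initSet V).ncard := by
  classical
  have : Fintype (initSet V) := Fintype.ofFinite _
  rw [← Nat.card_coe_set_eq, Nat.card_eq_fintype_card]
  apply le_antisymm
  · let T : V →ₗ[K] (initSet V → K) :=
      LinearMap.pi fun A => (monomialBasis K n).coord A.1 ∘ₗ V.subtype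
    have hT : Function.Injective T := by
      rw [← LinearMap.ker_eq_bot, LinearMap.ker_eq_bot']
      intro f hf
      by_contra h0
      obtain ⟨A, hA⟩ := exists_isInitialMonomial (fun h => h0 (Subtype.ext h))
      exact hA.1 (congrFun hf ⟨A, f, f.2, hA⟩)
    simpa using LinearMap.finrank_le_finrank_of_injective hT
  · choose f hfV hf using fun A : initSet V => A.2
    have hli : LinearIndependent K (fun A => (⟨f A, hfV A⟩ : V)) := by
      rw [Fintype.linearIndependent_iff]
      intro g hg
      by_contra! hne
      obtain ⟨A₀, hA₀⟩ := hne
      obtain ⟨_, ⟨A, hgA, rfl⟩, hmax⟩ :=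
        exists_maximal_rlex (Subtype.val '' {A : initSet V | g A ≠ 0}) ⟨_, A₀, hA₀, rfl⟩
      have h1 : (monomialBasis K n).repr (∑ B, g B • f B) A = 0 := by
        have : ∑ B, g B • f B = 0 := by simpa using congrArg Subtype.val hg
        rw [this]; simp
      rw [map_sum, Finsupp.finsetSum_apply, Finset.sum_eq_single A] at h1
      · rw [map_smul, Finsupp.smul_apply, smul_eq_mul, mul_eq_zero] at h1
        exact h1.elim hgA (hf A).1
      · intro B _ hBA
        rw [map_smul, Finsupp.smul_apply, smul_eq_mul]
        by_cases hgB : g B = 0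
        · simp [hgB]
        · rw [(hf B).repr_eq_zero (hmax B ⟨B, hgB, rfl⟩ (fun h => hBA (Subtype.ext h))), mul_zero]
      · simp
    exact hli.fintype_card_le_finrank

end InitialMonomials

/-! ### Initial ideals -/

section InitialIdeals

variable {K : Type*} [Field K] {n : ℕ}

theorem ι_eq_sum_gen (v : Fin n → K) :
    ExteriorAlgebra.ι K v = ∑ k, v k • (gen K k : E K n) := by
  conv_lhs => rw [pi_eq_sum_univ' v]
  simp only [map_sum, map_smul, gen]

theorem exists_ι_mul_eq_mul_ι (v : Fin n → K) (x : E K n) :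
    ∃ y : E K n, ExteriorAlgebra.ι K v * x = y * ExteriorAlgebra.ι K v := by
  induction x using ExteriorAlgebra.induction with
  | algebraMap r => exact ⟨algebraMap K _ r, (Algebra.commutes r _).symm⟩
  | ι w =>
    exact ⟨-ExteriorAlgebra.ι K w, by
      rw [neg_mul]; exact eq_neg_of_add_eq_zero_left (ExteriorAlgebra.ι_add_mul_swap v w)⟩
  | mul a b ha hb =>
    obtain ⟨a', ha⟩ := ha
    obtain ⟨b', hb⟩ := hb
    exact ⟨a' * b', by rw [← mul_assoc, ha, mul_assoc, hb, mul_assoc]⟩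
  | add a b ha hb =>
    obtain ⟨a', ha⟩ := ha
    obtain ⟨b', hb⟩ := hb
    exact ⟨a' + b', by rw [mul_add, ha, hb, add_mul]⟩

theorem exists_mul_ι_eq_ι_mul (v : Fin n → K) (x : E K n) :
    ∃ y : E K n, x * ExteriorAlgebra.ι K v = ExteriorAlgebra.ι K v * y := by
  induction x using ExteriorAlgebra.induction with
  | algebraMap r => exact ⟨algebraMap K _ r, Algebra.commutes r _⟩
  | ι w =>
    exact ⟨-ExteriorAlgebra.ι K w, by
      rw [mul_neg]; exact eq_neg_of_add_eq_zero_left (ExteriorAlgebra.ι_add_mul_swap w v)⟩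
  | mul a b ha hb =>
    obtain ⟨a', ha⟩ := ha
    obtain ⟨b', hb⟩ := hb
    exact ⟨a' * b', by rw [mul_assoc, hb, ← mul_assoc, ha, mul_assoc]⟩
  | add a b ha hb =>
    obtain ⟨a', ha⟩ := ha
    obtain ⟨b', hb⟩ := hb
    exact ⟨a' + b', by rw [add_mul, ha, hb, mul_add]⟩

/-- The `K`-span of the monomials `e_A` with `A ∈ S`. -/
def monomialSpan (K : Type*) [Field K] {n : ℕ} (S : Set (Finset (Fin n))) :
    Submodule K (E K n) :=
  Submodule.span K (monomialBasis K n '' S)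

theorem mem_monomialSpan {S : Set (Finset (Fin n))} {f : E K n} :
    f ∈ monomialSpan K S ↔ ∀ A, (monomialBasis K n).repr f A ≠ 0 → A ∈ S := by
  rw [monomialSpan, Module.Basis.mem_span_image]
  simp [Set.subset_def]

theorem monomialBasis_mem_monomialSpan {S : Set (Finset (Fin n))} {A : Finset (Fin n)}
    (h : A ∈ S) : monomialBasis K n A ∈ monomialSpan K S :=
  Submodule.subset_span ⟨A, h, rfl⟩

theorem mul_mem_monomialSpan {S : Set (Finset (Fin n))}
    (hS : ∀ A ∈ S, ∀ k ∉ A, insert k A ∈ S) (x : E K n) {f : E K n}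
    (hf : f ∈ monomialSpan K S) : x * f ∈ monomialSpan K S := by
  induction x using ExteriorAlgebra.induction generalizing f with
  | algebraMap r =>
    rw [← Algebra.smul_def]
    exact Submodule.smul_mem _ r hf
  | ι v =>
    rw [ι_eq_sum_gen, Finset.sum_mul]
    refine Submodule.sum_mem _ fun k _ => ?_
    rw [smul_mul_assoc]
    refine Submodule.smul_mem _ _ ?_
    rw [mem_monomialSpan] at hf ⊢
    intro C hC
    obtain ⟨ε, -, h⟩ := exists_repr_gen_mul (K := K) k
    rw [h] at hC
    split_ifs at hC with hk
    · have := hS _ (hf _ (right_ne_zero_of_mul hC)) k (Finset.notMem_erase k C)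
      rwa [Finset.insert_erase hk] at this
    · exact absurd rfl hC
  | mul a b ha hb => rw [mul_assoc]; exact ha (hb hf)
  | add a b ha hb => rw [add_mul]; exact Submodule.add_mem _ (ha hf) (hb hf)

theorem insert_mem_initSet {J : Ideal (E K n)} {A : Finset (Fin n)}
    (hA : A ∈ initSet (J.restrictScalars K)) {k : Fin n} (hk : k ∉ A) :
    insert k A ∈ initSet (J.restrictScalars K) := by
  obtain ⟨f, hf, h1, h2⟩ := hA
  obtain ⟨ε, h0, h⟩ := exists_repr_gen_mul (K := K) k
  refine ⟨gen K k * f, J.mul_mem_left _ hf, ?_, fun C hC hne => ?_⟩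
  · rw [h, if_pos (Finset.mem_insert_self k A), Finset.erase_insert hk]
    exact mul_ne_zero (h0 _) h1
  · rw [h] at hC
    split_ifs at hC with hkC
    · have := (h2 _ (right_ne_zero_of_mul hC) (fun he => hne (by
        rw [← he, Finset.insert_erase hkC]))).insert (Finset.notMem_erase k C) hk
      rwa [Finset.insert_erase hkC] at this
    · exact absurd rfl hC

theorem initialIdeal_eq_span (J : Ideal (E K n)) :
    initialIdeal J = Ideal.span (monomialBasis K n '' initSet (J.restrictScalars K)) := by
  rw [initialIdeal]
  congr 1
  ext m
  constructor
  · rintro ⟨f, hf, A, hA, rfl⟩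
    exact ⟨A, ⟨f, hf, hA⟩, rfl⟩
  · rintro ⟨A, ⟨f, hf, hA⟩, rfl⟩
    exact ⟨f, hf, A, hA, rfl⟩

/-- Since the initial monomials of a left ideal are closed under multiplication, they already span
the initial ideal over `K`. -/
theorem mem_initialIdeal_iff {J : Ideal (E K n)} {f : E K n} :
    f ∈ initialIdeal J ↔ f ∈ monomialSpan K (initSet (J.restrictScalars K)) := by
  rw [initialIdeal_eq_span]
  constructor
  · intro hf
    induction hf using Submodule.span_induction with
    | mem f hf => exact Submodule.subset_span hf
    | zero => exact Submodule.zero_mem _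
    | add f g _ _ hf hg => exact Submodule.add_mem _ hf hg
    | smul x f _ hf =>
      exact mul_mem_monomialSpan (fun A hA k hk => insert_mem_initSet hA hk) x hf
  · intro hf
    have : monomialSpan K (initSet (J.restrictScalars K)) ≤
        (Ideal.span (monomialBasis K n '' initSet (J.restrictScalars K))).restrictScalars K :=
      Submodule.span_le.2 Ideal.subset_span
    exact this hf

theorem initSet_initialIdeal (J : Ideal (E K n)) :
    initSet ((initialIdeal J).restrictScalars K) = initSet (J.restrictScalars K) := by
  ext A
  constructor
  · rintro ⟨f, hf, hA⟩
    exact mem_monomialSpan.1 (mem_initialIdeal_iff.1 hf) A hA.1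
  · intro hA
    exact ⟨_, mem_initialIdeal_iff.2 (monomialBasis_mem_monomialSpan hA),
      isInitialMonomial_monomialBasis A⟩

theorem isHomogeneous_initialIdeal (J : Ideal (E K n)) :
    (initialIdeal J).IsHomogeneous (fun d : ℕ => ⋀[K]^d (Fin n → K)) := by
  rw [initialIdeal_eq_span]
  apply Ideal.homogeneous_span
  rintro _ ⟨A, -, rfl⟩
  exact ⟨_, monomialBasis_mem A⟩

/-- The left ideal generated by the variables `e_k`, `k ∈ T`, is spanned by the monomials divisible
by one of these variables. -/
theorem mem_span_gen_iff {T : Set (Fin n)} {f : E K n} :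
    f ∈ Ideal.span (gen K '' T) ↔ f ∈ monomialSpan K {A | ∃ k ∈ T, k ∈ A} := by
  constructor
  · intro hf
    induction hf using Submodule.span_induction with
    | mem f hf =>
      obtain ⟨k, hk, rfl⟩ := hf
      rw [gen_eq_monomialBasis]
      exact monomialBasis_mem_monomialSpan ⟨k, hk, Finset.mem_singleton_self k⟩
    | zero => exact Submodule.zero_mem _
    | add f g _ _ hf hg => exact Submodule.add_mem _ hf hg
    | smul x f _ hf =>
      refine mul_mem_monomialSpan ?_ x hf
      rintro A ⟨l, hl, hA⟩ k -
      exact ⟨l, hl, Finset.mem_insert_of_mem hA⟩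
  · intro hf
    have : monomialSpan K {A | ∃ k ∈ T, k ∈ A} ≤ (Ideal.span (gen K '' T)).restrictScalars K := by
      refine Submodule.span_le.2 ?_
      rintro _ ⟨A, ⟨k, hkT, hkA⟩, rfl⟩
      obtain ⟨ε, h0, h⟩ := gen_mul_monomialBasis_of_notMem (K := K) (Finset.notMem_erase k A)
      rw [Finset.insert_erase hkA] at h
      obtain ⟨y, hy⟩ := exists_ι_mul_eq_mul_ι (Pi.single k (1 : K))
        (monomialBasis K n (A.erase k))
      have hA : monomialBasis K n A = ε⁻¹ • (y * gen K k) := by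
        rw [gen, ← hy, ← gen, h, inv_smul_smul₀ h0]
      rw [hA]
      exact Submodule.smul_mem _ _ (Ideal.mul_mem_left _ _ (Ideal.subset_span ⟨k, hkT, rfl⟩))
    exact this hf

/-- For the reverse lexicographic order, passing to the initial ideal commutes with adding an
initial segment of the variables. -/
theorem initSet_sup_span_gen {J : Ideal (E K n)}
    (hJ : J.IsHomogeneous (fun d : ℕ => ⋀[K]^d (Fin n → K))) {T : Set (Fin n)}
    (hT : IsLowerSet T) :
    initSet ((J ⊔ Ideal.span (gen K '' T)).restrictScalars K) =
      initSet (J.restrictScalars K) ∪ {A | ∃ k ∈ T, k ∈ A} := by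
  ext A
  constructor
  · rintro ⟨f, hf, hA⟩
    by_cases hAT : ∃ k ∈ T, k ∈ A
    · exact Or.inr hAT
    left
    obtain ⟨g, hg, h, hh, rfl⟩ := Submodule.mem_sup.1 hf
    rw [mem_span_gen_iff, mem_monomialSpan] at hh
    have key : ∀ B : Finset (Fin n), (¬ ∃ k ∈ T, k ∈ B) →
        (monomialBasis K n).repr (g + h) B = (monomialBasis K n).repr g B := by
      intro B hB
      rw [map_add, Finsupp.add_apply, not_not.1 (mt (hh B) hB), add_zero]
    refine ⟨homPart A.card g, homPart_mem_ideal hJ hg _, ?_, fun B hB hne => ?_⟩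
    · rw [repr_homPart, if_pos rfl, ← key A hAT]
      exact hA.1
    · rw [repr_homPart] at hB
      split_ifs at hB with hc
      · by_cases hBT : ∃ k ∈ T, k ∈ B
        · exact RlexLT.of_mem_of_forall_notMem hc hT hBT hAT
        · exact hA.2 B (by rwa [key B hBT]) hne
      · exact absurd rfl hB
  · rintro (hA | hA)
    · have hle : J.restrictScalars K ≤ (J ⊔ Ideal.span (gen K '' T)).restrictScalars K :=
        fun f hf => Submodule.mem_sup_left hf
      exact initSet_mono hle hA
    · exact ⟨_, Submodule.mem_sup_right
        (mem_span_gen_iff.2 (monomialBasis_mem_monomialSpan hA)),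
        isInitialMonomial_monomialBasis A⟩

theorem initSet_inf_exteriorPower {J : Ideal (E K n)}
    (hJ : J.IsHomogeneous (fun d : ℕ => ⋀[K]^d (Fin n → K))) (d : ℕ) :
    initSet (J.restrictScalars K ⊓ ⋀[K]^d (Fin n → K)) =
      {A ∈ initSet (J.restrictScalars K) | A.card = d} := by
  ext A
  constructor
  · rintro ⟨f, ⟨hf, hd⟩, hA⟩
    exact ⟨⟨f, hf, hA⟩, card_eq_of_mem hd hA.1⟩
  · rintro ⟨⟨f, hf, hA⟩, rfl⟩
    refine ⟨homPart A.card f, ⟨homPart_mem_ideal hJ hf _, homPart_mem _ _⟩, ?_, fun B hB => ?_⟩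
    · rw [repr_homPart, if_pos rfl]
      exact hA.1
    · rw [repr_homPart] at hB
      exact hA.2 B (ite_ne_right_iff.1 hB).2

theorem isHomogeneous_span_gen (T : Set (Fin n)) :
    (Ideal.span (gen K '' T) : Ideal (E K n)).IsHomogeneous
      (fun d : ℕ => ⋀[K]^d (Fin n → K)) := by
  apply Ideal.homogeneous_span
  rintro _ ⟨k, -, rfl⟩
  rw [gen_eq_monomialBasis]
  exact ⟨_, monomialBasis_mem _⟩

/-- `E/(J + (e_k : k ∈ T))` and `E/(in(J) + (e_k : k ∈ T))` have the same Hilbert function. -/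
theorem finrank_initialIdeal_sup_inf {J : Ideal (E K n)}
    (hJ : J.IsHomogeneous (fun d : ℕ => ⋀[K]^d (Fin n → K))) {T : Set (Fin n)}
    (hT : IsLowerSet T) (j : ℤ) :
    Module.finrank K ((initialIdeal J ⊔ Ideal.span (gen K '' T)).restrictScalars K ⊓
        extGrading K n j : Submodule K (E K n)) =
      Module.finrank K ((J ⊔ Ideal.span (gen K '' T)).restrictScalars K ⊓
        extGrading K n j : Submodule K (E K n)) := by
  cases j with
  | ofNat d =>
    change Module.finrank K (_ ⊓ ⋀[K]^d (Fin n → K) : Submodule K (E K n)) =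
      Module.finrank K (_ ⊓ ⋀[K]^d (Fin n → K) : Submodule K (E K n))
    rw [finrank_eq_ncard_initSet, finrank_eq_ncard_initSet,
      initSet_inf_exteriorPower ((isHomogeneous_initialIdeal J).sup (isHomogeneous_span_gen T)),
      initSet_inf_exteriorPower (hJ.sup (isHomogeneous_span_gen T)),
      initSet_sup_span_gen (isHomogeneous_initialIdeal J) hT, initSet_sup_span_gen hJ hT,
      initSet_initialIdeal]
  | negSucc d =>
    change Module.finrank K (_ ⊓ ⊥ : Submodule K (E K n)) =
      Module.finrank K (_ ⊓ ⊥ : Submodule K (E K n))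
    rw [inf_bot_eq, inf_bot_eq]

end InitialIdeals

/-! ### Annihilator numbers in terms of Hilbert functions -/

section LinearAlgebra

variable {K X Y : Type*} [Field K] [AddCommGroup X] [Module K X] [AddCommGroup Y] [Module K Y]

theorem finrank_map_add_finrank_ker_inf [Module.Finite K X] (f : X →ₗ[K] Y)
    (S : Submodule K X) :
    Module.finrank K (S.map f) + Module.finrank K (LinearMap.ker f ⊓ S : Submodule K X) =
      Module.finrank K S := by
  rw [← LinearMap.finrank_range_add_finrank_ker (f.domRestrict S), LinearMap.range_domRestrict,
    LinearMap.ker_domRestrict, inf_comm, ← Submodule.map_comap_subtype,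
    Submodule.finrank_map_subtype_eq]

theorem finrank_quotient_comap_subtype [Module.Finite K Y] {B Z : Submodule K Y} (h : B ≤ Z) :
    Module.finrank K (Z ⧸ B.comap Z.subtype) + Module.finrank K B = Module.finrank K Z := by
  rw [← Submodule.finrank_quotient_add_finrank (B.comap Z.subtype),
    (Submodule.comapSubtypeEquivOfLe h).finrank_eq]

/-- Let `A → B → C` be subspaces of `X` joined by `D`, `D² = 0`, and let `D'` be the map induced by
`D` on the quotient `π : X → Y` with kernel `Q`. If `Q'` is generated by `Q` and the image of `D`,
then the dimension of the homology of `π(A) → π(B) → π(C)` is determined by those of `B`,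
`Q ∩ C`, `Q' ∩ B`, and `Q' ∩ C`. -/
theorem finrank_homology_add [Module.Finite K X] [Module.Finite K Y] (π : X →ₗ[K] Y)
    (D : X →ₗ[K] X) (D' : Y →ₗ[K] Y) (hπ : ∀ x, π (D x) = D' (π x)) (hD : ∀ x, D (D x) = 0)
    {A B C Q Q' : Submodule K X} (hQ : LinearMap.ker π = Q) (hAB : A.map D ≤ B)
    (hBC : B.map D ≤ C) (hB : Q' ⊓ B = (Q ⊓ B) ⊔ A.map D) (hC : Q' ⊓ C = (Q ⊓ C) ⊔ B.map D) :
    Module.finrank K ((B.map π ⊓ LinearMap.ker D' : Submodule K Y) ⧸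
        ((A.map π).map D').comap (B.map π ⊓ LinearMap.ker D').subtype) +
      Module.finrank K (Q' ⊓ C : Submodule K X) + Module.finrank K (Q' ⊓ B : Submodule K X) =
    Module.finrank K B + Module.finrank K (Q ⊓ C : Submodule K X) := by
  have hmap : ∀ S : Submodule K X, (S.map π).map D' = (S.map D).map π := by
    intro S
    rw [← Submodule.map_comp, ← Submodule.map_comp]
    congr 1
    ext x
    exact (hπ x).symm
  have hle : (A.map π).map D' ≤ B.map π ⊓ LinearMap.ker D' := by
    refine le_inf ?_ ?_
    · rw [hmap]; exact Submodule.map_mono hAB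
    · rintro _ ⟨_, ⟨x, -, rfl⟩, rfl⟩
      rw [LinearMap.mem_ker, ← hπ, ← hπ, hD, map_zero]
  have e1 := finrank_quotient_comap_subtype hle
  have e2 := finrank_map_add_finrank_ker_inf D' (B.map π)
  rw [inf_comm] at e2
  have e3 := finrank_map_add_finrank_ker_inf π B
  have e4 := finrank_map_add_finrank_ker_inf π (A.map D)
  have e5 := finrank_map_add_finrank_ker_inf π (B.map D)
  rw [hmap] at e1 e2
  have e6 := Submodule.finrank_sup_add_finrank_inf_eq (Q ⊓ B) (A.map D)
  have e7 := Submodule.finrank_sup_add_finrank_inf_eq (Q ⊓ C) (B.map D)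
  rw [← hB, inf_assoc, inf_eq_right.2 hAB] at e6
  rw [← hC, inf_assoc, inf_eq_right.2 hBC] at e7
  rw [hQ] at e3 e4 e5
  rw [hmap A]
  omega

end LinearAlgebra

section Annihilator

variable {K : Type*} [Field K] {n : ℕ}

theorem ι_mem_exteriorPower_one (w : Fin n → K) :
    ExteriorAlgebra.ι K w ∈ ⋀[K]^1 (Fin n → K) := by
  change _ ∈ (LinearMap.range (ExteriorAlgebra.ι K (M := Fin n → K))) ^ 1
  rw [pow_one]
  exact ⟨w, rfl⟩

theorem ι_mul_mem_extGrading (w : Fin n → K) {j : ℤ} {x : E K n} (hx : x ∈ extGrading K n j) :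
    ExteriorAlgebra.ι K w * x ∈ extGrading K n (j + 1) := by
  cases j with
  | ofNat d =>
    change _ ∈ (LinearMap.range (ExteriorAlgebra.ι K (M := Fin n → K))) ^ (d + 1)
    rw [pow_succ']
    exact Submodule.mul_mem_mul ⟨w, rfl⟩ hx
  | negSucc d =>
    have hx : x = 0 := hx
    rw [hx, mul_zero]
    exact Submodule.zero_mem _

/-- The component of degree `j + 1` of `Q + (v)` is `Q_{j+1} + v E_j`, for a graded ideal `Q` and
`v ∈ E₁`. -/
theorem sup_span_singleton_inf_extGrading {Q : Ideal (E K n)}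
    (hQ : Q.IsHomogeneous (fun d : ℕ => ⋀[K]^d (Fin n → K))) (w : Fin n → K) (j : ℤ) :
    (Q ⊔ Ideal.span {ExteriorAlgebra.ι K w}).restrictScalars K ⊓ extGrading K n (j + 1) =
      (Q.restrictScalars K ⊓ extGrading K n (j + 1)) ⊔
        (extGrading K n j).map (mulBy (E K n) (ExteriorAlgebra.ι K w)) := by
  apply le_antisymm
  · rintro y ⟨hy, hyd⟩
    obtain ⟨a, ha, b, hb, rfl⟩ := Submodule.mem_sup.1 hy
    obtain ⟨c, rfl⟩ := Ideal.mem_span_singleton'.1 hb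
    obtain ⟨x, hx⟩ := exists_mul_ι_eq_ι_mul w c
    rw [hx] at hyd ⊢
    have hι := ι_mem_exteriorPower_one w
    -- only the components of degree `j + 1` matter; in degree `0` there is no contribution of `v`
    obtain hj | ⟨d, rfl⟩ | rfl : j + 1 < 0 ∨ (∃ d : ℕ, j = d) ∨ j = -1 := by
      rcases lt_trichotomy j (-1) with h | h | h
      · exact Or.inl (by omega)
      · exact Or.inr (Or.inr h)
      · exact Or.inr (Or.inl ⟨j.toNat, by omega⟩)
    · obtain ⟨m, hm⟩ := Int.eq_negSucc_of_lt_zero hj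
      rw [hm] at hyd
      have hyd : _ = (0 : E K n) := hyd
      rw [hyd]
      exact Submodule.zero_mem _
    · change _ ∈ ⋀[K]^(d + 1) (Fin n → K) at hyd
      have hx' : homPart (d + 1) (ExteriorAlgebra.ι K w * x) =
          ExteriorAlgebra.ι K w * homPart d x := by
        simp only [homPart, GradedAlgebra.proj_apply]
        rw [add_comm d 1]
        exact DirectSum.coe_decompose_mul_add_of_left_mem
          (fun d : ℕ => ⋀[K]^d (Fin n → K)) hι
      rw [← homPart_of_mem hyd, map_add, hx']
      exact Submodule.add_mem_sup ⟨homPart_mem_ideal hQ ha _, homPart_mem (d + 1) a⟩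
        ⟨_, homPart_mem d x, rfl⟩
    · change _ ∈ ⋀[K]^0 (Fin n → K) at hyd
      have hx' : homPart 0 (ExteriorAlgebra.ι K w * x) = 0 := by
        simp only [homPart, GradedAlgebra.proj_apply]
        exact DirectSum.coe_decompose_mul_of_left_mem_of_not_le
          (fun d : ℕ => ⋀[K]^d (Fin n → K)) hι (by omega)
      rw [← homPart_of_mem hyd, map_add, hx', add_zero]
      exact Submodule.mem_sup_left ⟨homPart_mem_ideal hQ ha _, homPart_mem 0 a⟩
  · refine sup_le (inf_le_inf_right _ fun x hx => Submodule.mem_sup_left hx) ?_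
    rintro _ ⟨x, hx, rfl⟩
    refine ⟨?_, ι_mul_mem_extGrading w hx⟩
    obtain ⟨y, hy⟩ := exists_ι_mul_eq_mul_ι w x
    change ExteriorAlgebra.ι K w * x ∈ Q ⊔ Ideal.span {ExteriorAlgebra.ι K w}
    rw [hy]
    exact Submodule.mem_sup_right (Ideal.mul_mem_left _ _ (Ideal.subset_span rfl))

theorem seqSubmodule_eq_map (J : Ideal (E K n)) (w : Fin n → Fin n → K) (i : Fin n) :
    seqSubmodule (E K n ⧸ J) (fun k => ExteriorAlgebra.ι K (w k)) i =
      Submodule.map J.mkQ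
        (Ideal.span ((fun k => ExteriorAlgebra.ι K (w k)) '' Set.Iio i)) := by
  apply le_antisymm
  · refine Submodule.span_le.2 ?_
    rintro _ ⟨k, hk, m, rfl⟩
    obtain ⟨x, rfl⟩ := J.mkQ_surjective m
    obtain ⟨y, hy⟩ := exists_ι_mul_eq_mul_ι (w k) x
    refine ⟨ExteriorAlgebra.ι K (w k) * x, ?_, rfl⟩
    rw [hy]
    exact Ideal.mul_mem_left _ _ (Ideal.subset_span ⟨k, hk, rfl⟩)
  · rw [Ideal.span, Submodule.map_span]
    refine Submodule.span_le.2 ?_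
    rintro _ ⟨_, ⟨k, hk, rfl⟩, rfl⟩
    refine Submodule.subset_span ⟨k, hk, J.mkQ 1, ?_⟩
    rw [← map_smul, smul_eq_mul, mul_one]

/-- The annihilator numbers of `E/J` with respect to `v₁, …, vₙ` are determined by the dimensions of
the graded components of the ideals `J + (v₁, …, v_{i-1})` and `J + (v₁, …, v_i)`. -/
theorem alpha_add {J : Ideal (E K n)}
    (hJ : J.IsHomogeneous (fun d : ℕ => ⋀[K]^d (Fin n → K))) (w : Fin n → Fin n → K)
    (i : Fin n) (j : ℤ) :
    alpha (fun k => ExteriorAlgebra.ι K (w k)) J i j +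
      Module.finrank K ((J ⊔ Ideal.span ((fun k => ExteriorAlgebra.ι K (w k)) ''
        Set.Iic i)).restrictScalars K ⊓ extGrading K n (j + 1) : Submodule K (E K n)) +
      Module.finrank K ((J ⊔ Ideal.span ((fun k => ExteriorAlgebra.ι K (w k)) ''
        Set.Iic i)).restrictScalars K ⊓ extGrading K n j : Submodule K (E K n)) =
    Module.finrank K (extGrading K n j) +
      Module.finrank K ((J ⊔ Ideal.span ((fun k => ExteriorAlgebra.ι K (w k)) ''
        Set.Iio i)).restrictScalars K ⊓ extGrading K n (j + 1) : Submodule K (E K n)) := by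
  set v : Fin n → E K n := fun k => ExteriorAlgebra.ι K (w k) with hv
  set Q : Ideal (E K n) := J ⊔ Ideal.span (v '' Set.Iio i) with hQdef
  have hQ : Q.IsHomogeneous (fun d : ℕ => ⋀[K]^d (Fin n → K)) := by
    refine hJ.sup (Ideal.homogeneous_span _ _ ?_)
    rintro _ ⟨k, -, rfl⟩
    exact ⟨1, ι_mem_exteriorPower_one (w k)⟩
  have hQ' : J ⊔ Ideal.span (v '' Set.Iic i) = Q ⊔ Ideal.span {ExteriorAlgebra.ι K (w i)} := by
    rw [← Set.Iio_insert, Set.image_insert_eq, Ideal.span_insert, hQdef, sup_assoc,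
      sup_comm (Ideal.span {v i})]
  rw [hQ']
  let N := seqSubmodule (E K n ⧸ J) v i
  let π : E K n →ₗ[K] (E K n ⧸ J) ⧸ N :=
    N.mkQ.restrictScalars K ∘ₗ J.mkQ.restrictScalars K
  have hπ : Function.Surjective π := (N.mkQ_surjective).comp J.mkQ_surjective
  have : Module.Finite K ((E K n ⧸ J) ⧸ N) := Module.Finite.of_surjective π hπ
  have hker : LinearMap.ker π = Q.restrictScalars K := by
    ext x
    rw [LinearMap.mem_ker]
    change N.mkQ (J.mkQ x) = 0 ↔ x ∈ Q
    rw [Submodule.mkQ_apply, Submodule.Quotient.mk_eq_zero, ← Submodule.mem_comap]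
    change x ∈ Submodule.comap J.mkQ (seqSubmodule (E K n ⧸ J) v i) ↔ _
    rw [seqSubmodule_eq_map, Submodule.comap_map_mkQ]
  have h := finrank_homology_add π (mulBy (E K n) (v i)) (mulBy ((E K n ⧸ J) ⧸ N) (v i))
    (A := extGrading K n (j - 1)) (B := extGrading K n j) (C := extGrading K n (j + 1))
    (Q := Q.restrictScalars K)
    (Q' := (Q ⊔ Ideal.span {ExteriorAlgebra.ι K (w i)}).restrictScalars K)
    (fun x => rfl)
    (fun x => by
      change v i * (v i * x) = 0
      rw [← mul_assoc, hv, ExteriorAlgebra.ι_sq_zero, zero_mul])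
    hker
    (by
      rintro _ ⟨x, hx, rfl⟩
      rw [← sub_add_cancel j 1]
      exact ι_mul_mem_extGrading (w i) (by simpa using hx))
    (by
      rintro _ ⟨x, hx, rfl⟩
      exact ι_mul_mem_extGrading (w i) hx)
    (by simpa using sup_span_singleton_inf_extGrading hQ (w i) (j - 1))
    (sup_span_singleton_inf_extGrading hQ (w i) j)
  have hmap : ∀ S : Submodule K (E K n), S.map π =
      (S.map (J.mkQ.restrictScalars K)).map (N.mkQ.restrictScalars K) :=
    fun S => Submodule.map_comp _ _ S
  rw [hmap, hmap] at h
  exact h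

end Annihilator

/-! ### Linear changes of coordinates -/

section Action

variable {K : Type*} [Field K] {n : ℕ}

theorem action_ι (φ : GL (Fin n) K) (v : Fin n → K) :
    action φ (ExteriorAlgebra.ι K v) = ExteriorAlgebra.ι K (φ.val *ᵥ v) := by
  rw [action, ExteriorAlgebra.map_apply_ι, Matrix.toLin'_apply]

theorem transformedSeq_eq_ι (φ : GL (Fin n) K) (k : Fin n) :
    transformedSeq φ k = ExteriorAlgebra.ι K (φ.val *ᵥ Pi.single k 1) := by
  rw [ι_eq_sum_gen]
  simp [transformedSeq]

theorem action_inv_transformedSeq (φ : GL (Fin n) K) (k : Fin n) :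
    action φ⁻¹ (transformedSeq φ k) = gen K k := by
  rw [transformedSeq_eq_ι, action_ι, Matrix.mulVec_mulVec, ← Units.val_mul, inv_mul_cancel,
    Units.val_one, Matrix.one_mulVec, gen]

theorem action_mul (φ ψ : GL (Fin n) K) :
    action (φ * ψ) = (action φ).comp (action ψ) := by
  refine ExteriorAlgebra.hom_ext (LinearMap.ext fun v => ?_)
  change action (φ * ψ) (ExteriorAlgebra.ι K v) = action φ (action ψ (ExteriorAlgebra.ι K v))
  rw [action_ι, action_ι, action_ι, Matrix.mulVec_mulVec, Units.val_mul]

theorem action_one : action (1 : GL (Fin n) K) = AlgHom.id K (E K n) := by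
  refine ExteriorAlgebra.hom_ext (LinearMap.ext fun v => ?_)
  change action 1 (ExteriorAlgebra.ι K v) = ExteriorAlgebra.ι K v
  rw [action_ι, Units.val_one, Matrix.one_mulVec]

theorem action_action_inv (φ : GL (Fin n) K) (x : E K n) : action φ (action φ⁻¹ x) = x := by
  rw [← AlgHom.comp_apply, ← action_mul, mul_inv_cancel, action_one, AlgHom.id_apply]

theorem action_inv_action (φ : GL (Fin n) K) (x : E K n) : action φ⁻¹ (action φ x) = x := by
  rw [← AlgHom.comp_apply, ← action_mul, inv_mul_cancel, action_one, AlgHom.id_apply]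

theorem action_mem_exteriorPower (φ : GL (Fin n) K) {d : ℕ} {x : E K n}
    (hx : x ∈ ⋀[K]^d (Fin n → K)) : action φ x ∈ ⋀[K]^d (Fin n → K) := by
  have h : (⋀[K]^d (Fin n → K)).map (action φ).toLinearMap ≤ ⋀[K]^d (Fin n → K) := by
    change Submodule.map _ ((LinearMap.range (ExteriorAlgebra.ι K (M := Fin n → K))) ^ d) ≤
      (LinearMap.range (ExteriorAlgebra.ι K (M := Fin n → K))) ^ d
    rw [Submodule.map_pow]
    refine pow_le_pow_left' ?_ d
    rintro _ ⟨_, ⟨v, rfl⟩, rfl⟩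
    exact ⟨_, (action_ι φ v).symm⟩
  exact h ⟨x, hx, rfl⟩

theorem action_mem_extGrading (φ : GL (Fin n) K) {j : ℤ} {x : E K n}
    (hx : x ∈ extGrading K n j) : action φ x ∈ extGrading K n j := by
  cases j with
  | ofNat d => exact action_mem_exteriorPower φ hx
  | negSucc d =>
    have hx : x = 0 := hx
    rw [hx, map_zero]
    exact Submodule.zero_mem _

theorem homPart_action (φ : GL (Fin n) K) (d : ℕ) (x : E K n) :
    homPart d (action φ x) = action φ (homPart d x) := by
  induction x using monomial_induction with
  | zero => simp
  | add f g hf hg => simp only [map_add, hf, hg]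
  | smul a f hf => simp only [map_smul, hf]
  | basis A =>
    have h := action_mem_exteriorPower φ (monomialBasis_mem (K := K) A)
    by_cases hA : A.card = d
    · subst hA
      rw [homPart_of_mem h, homPart_of_mem (monomialBasis_mem A)]
    · rw [homPart_of_mem_of_ne h hA, homPart_of_mem_of_ne (monomialBasis_mem A) hA, map_zero]

theorem mem_map_action_iff {φ : GL (Fin n) K} {J : Ideal (E K n)} {x : E K n} :
    x ∈ J.map (action φ) ↔ ∃ y ∈ J, action φ y = x :=
  Ideal.mem_map_iff_of_surjective (action φ) fun x => ⟨_, action_action_inv φ x⟩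

theorem isHomogeneous_map_action {J : Ideal (E K n)}
    (hJ : J.IsHomogeneous (fun d : ℕ => ⋀[K]^d (Fin n → K))) (φ : GL (Fin n) K) :
    (J.map (action φ)).IsHomogeneous (fun d : ℕ => ⋀[K]^d (Fin n → K)) := by
  intro d x hx
  obtain ⟨y, hy, rfl⟩ := mem_map_action_iff.1 hx
  rw [← GradedAlgebra.proj_apply]
  change homPart d (action φ y) ∈ _
  rw [homPart_action]
  exact Ideal.mem_map_of_mem _ (homPart_mem_ideal hJ hy d)

theorem map_action_inv_map_action (φ : GL (Fin n) K) (J : Ideal (E K n)) :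
    (J.map (action φ)).map (action φ⁻¹) = J := by
  ext x
  simp only [mem_map_action_iff]
  constructor
  · rintro ⟨_, ⟨y, hy, rfl⟩, rfl⟩
    rwa [action_inv_action]
  · intro hx
    exact ⟨_, ⟨x, hx, rfl⟩, action_inv_action φ x⟩

theorem finrank_map_action_inf (φ : GL (Fin n) K) (J : Ideal (E K n)) (j : ℤ) :
    Module.finrank K ((J.map (action φ)).restrictScalars K ⊓ extGrading K n j :
        Submodule K (E K n)) =
      Module.finrank K (J.restrictScalars K ⊓ extGrading K n j : Submodule K (E K n)) := by
  have key : ∀ (ψ : GL (Fin n) K) (I : Ideal (E K n)),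
      Module.finrank K (I.restrictScalars K ⊓ extGrading K n j : Submodule K (E K n)) ≤
      Module.finrank K ((I.map (action ψ)).restrictScalars K ⊓ extGrading K n j :
        Submodule K (E K n)) := by
    intro ψ I
    have hinj : Function.Injective (action ψ).toLinearMap :=
      Function.LeftInverse.injective (action_inv_action ψ)
    rw [(Submodule.equivMapOfInjective _ hinj _).finrank_eq]
    refine Submodule.finrank_mono ?_
    rintro _ ⟨x, ⟨hx, hxj⟩, rfl⟩
    exact ⟨Ideal.mem_map_of_mem _ hx, action_mem_extGrading ψ hxj⟩
  refine le_antisymm ?_ (key φ J)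
  have h := key φ⁻¹ (J.map (action φ))
  rwa [map_action_inv_map_action] at h

/-- The annihilator numbers are invariant under linear changes of coordinates. -/
theorem alpha_transformedSeq {J : Ideal (E K n)}
    (hJ : J.IsHomogeneous (fun d : ℕ => ⋀[K]^d (Fin n → K))) (γ : GL (Fin n) K)
    (i : Fin n) (j : ℤ) :
    alpha (transformedSeq γ) J i j = alpha (gen K) (J.map (action γ⁻¹)) i j := by
  have hsup : ∀ T : Set (Fin n), J.map (action γ⁻¹) ⊔ Ideal.span (gen K '' T) =
      (J ⊔ Ideal.span (transformedSeq γ '' T)).map (action γ⁻¹) := by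
    intro T
    rw [Ideal.map_sup, Ideal.map_span, ← Set.image_comp]
    congr 3
    ext k
    exact (action_inv_transformedSeq γ k).symm
  have h1 := alpha_add hJ (fun k => γ.val *ᵥ Pi.single k 1) i j
  have h2 := alpha_add (isHomogeneous_map_action hJ γ⁻¹) (fun k => Pi.single k 1) i j
  have e1 : (fun k => ExteriorAlgebra.ι K (γ.val *ᵥ Pi.single k 1)) = transformedSeq γ :=
    funext fun k => (transformedSeq_eq_ι γ k).symm
  have e2 : (fun k : Fin n => ExteriorAlgebra.ι K (Pi.single k 1)) = gen K := rfl
  rw [e1] at h1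
  rw [e2, hsup, hsup, finrank_map_action_inf, finrank_map_action_inf, finrank_map_action_inf]
    at h2
  omega

/-- For coordinates in the given order, passing to the reverse lexicographic initial ideal does not
change the annihilator numbers. -/
theorem alpha_gen_initialIdeal {J : Ideal (E K n)}
    (hJ : J.IsHomogeneous (fun d : ℕ => ⋀[K]^d (Fin n → K))) (i : Fin n) (j : ℤ) :
    alpha (gen K) (initialIdeal J) i j = alpha (gen K) J i j := by
  have h1 := alpha_add hJ (fun k => Pi.single k 1) i j
  have h2 := alpha_add (isHomogeneous_initialIdeal J) (fun k => Pi.single k 1) i j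
  have e2 : (fun k : Fin n => ExteriorAlgebra.ι K (Pi.single k 1)) = gen K := rfl
  rw [e2] at h1 h2
  rw [finrank_initialIdeal_sup_inf hJ (isLowerSet_Iic i),
    finrank_initialIdeal_sup_inf hJ (isLowerSet_Iic i),
    finrank_initialIdeal_sup_inf hJ (isLowerSet_Iio i)] at h2
  omega

end Action

/-! ### Zariski-open subsets of the general linear group -/

section Zariski

variable {K : Type*} [Field K] {n : ℕ}

/-- The value of a polynomial in the matrix entries at `φ ∈ GL_n(K)`. -/
def evalGL (φ : GL (Fin n) K) : MvPolynomial (Fin n × Fin n) K →+* K :=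
  MvPolynomial.eval fun ij => φ.val ij.1 ij.2

theorem evalGL_C (φ : GL (Fin n) K) (a : K) : evalGL φ (MvPolynomial.C a) = a :=
  MvPolynomial.eval_C a

theorem evalGL_X (φ : GL (Fin n) K) (i j : Fin n) :
    evalGL φ (MvPolynomial.X (i, j)) = φ.val i j :=
  MvPolynomial.eval_X _

/-- A function on `GL_n(K)` that is given by a polynomial in the matrix entries. -/
def IsPolynomialFun (F : GL (Fin n) K → K) : Prop :=
  ∃ p, ∀ φ, F φ = evalGL φ p

theorem IsPolynomialFun.add {F G : GL (Fin n) K → K} (hF : IsPolynomialFun F)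
    (hG : IsPolynomialFun G) : IsPolynomialFun fun φ => F φ + G φ := by
  obtain ⟨p, hp⟩ := hF
  obtain ⟨q, hq⟩ := hG
  exact ⟨p + q, fun φ => by simp only [map_add, hp, hq]⟩

theorem IsPolynomialFun.mul {F G : GL (Fin n) K → K} (hF : IsPolynomialFun F)
    (hG : IsPolynomialFun G) : IsPolynomialFun fun φ => F φ * G φ := by
  obtain ⟨p, hp⟩ := hF
  obtain ⟨q, hq⟩ := hG
  exact ⟨p * q, fun φ => by simp only [map_mul, hp, hq]⟩

theorem isPolynomialFun_const (a : K) : IsPolynomialFun fun _ : GL (Fin n) K => a :=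
  ⟨MvPolynomial.C a, fun φ => (evalGL_C φ a).symm⟩

theorem isPolynomialFun_apply (i j : Fin n) :
    IsPolynomialFun fun φ : GL (Fin n) K => φ.val i j :=
  ⟨MvPolynomial.X (i, j), fun φ => (evalGL_X φ i j).symm⟩

theorem isPolynomialFun_sum {α : Type*} (s : Finset α) {F : α → GL (Fin n) K → K}
    (hF : ∀ a ∈ s, IsPolynomialFun (F a)) : IsPolynomialFun fun φ => ∑ a ∈ s, F a φ := by
  classical
  induction s using Finset.induction_on with
  | empty => simpa using isPolynomialFun_const 0
  | insert a s ha ih =>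
    simp only [Finset.sum_insert ha]
    exact (hF a (Finset.mem_insert_self a s)).add
      (ih fun b hb => hF b (Finset.mem_insert_of_mem hb))

theorem evalGL_mvPolynomialX (φ : GL (Fin n) K) :
    (evalGL φ).mapMatrix (Matrix.mvPolynomialX (Fin n) (Fin n) K) = φ.val := by
  ext i j
  exact evalGL_X φ i j

theorem exists_evalGL_ne_zero [Infinite K] {p : MvPolynomial (Fin n × Fin n) K} (hp : p ≠ 0) :
    ∃ φ : GL (Fin n) K, evalGL φ p ≠ 0 := by
  have h : p * (Matrix.mvPolynomialX (Fin n) (Fin n) K).det ≠ 0 :=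
    mul_ne_zero hp (Matrix.det_mvPolynomialX_ne_zero (Fin n) K)
  obtain ⟨x, hx⟩ : ∃ x : Fin n × Fin n → K,
      MvPolynomial.eval x (p * (Matrix.mvPolynomialX (Fin n) (Fin n) K).det) ≠ 0 := by
    by_contra! hx
    exact h (MvPolynomial.funext fun x => by rw [hx x, map_zero])
  rw [map_mul] at hx
  have hdet : (Matrix.of fun i j => x (i, j)).det ≠ 0 := by
    have := right_ne_zero_of_mul hx
    rw [RingHom.map_det] at this
    convert this using 2
    ext i j
    simp
  exact ⟨Matrix.GeneralLinearGroup.mkOfDetNeZero _ hdet, left_ne_zero_of_mul hx⟩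

/-- `GL_n(K)` is irreducible when `K` is infinite. -/
theorem exists_forall_evalGL_ne_zero [Infinite K] {α : Type*} (s : Finset α)
    (p : α → MvPolynomial (Fin n × Fin n) K)
    (hp : ∀ a ∈ s, ∃ φ : GL (Fin n) K, evalGL φ (p a) ≠ 0) :
    ∃ φ : GL (Fin n) K, ∀ a ∈ s, evalGL φ (p a) ≠ 0 := by
  have h : ∏ a ∈ s, p a ≠ 0 := by
    rw [Finset.prod_ne_zero_iff]
    intro a ha h0
    obtain ⟨φ, hφ⟩ := hp a ha
    rw [h0, map_zero] at hφ
    exact hφ rfl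
  obtain ⟨φ, hφ⟩ := exists_evalGL_ne_zero h
  rw [map_prod, Finset.prod_ne_zero_iff] at hφ
  exact ⟨φ, hφ⟩

theorem IsZariskiOpen.inter_nonempty [Infinite K] {U V : Set (GL (Fin n) K)}
    (hU : IsZariskiOpen U) (hV : IsZariskiOpen V) (hU' : U.Nonempty) (hV' : V.Nonempty) :
    (U ∩ V).Nonempty := by
  obtain ⟨S, hS⟩ := hU
  obtain ⟨T, hT⟩ := hV
  obtain ⟨φ, hφ⟩ := hU'
  obtain ⟨ψ, hψ⟩ := hV'
  obtain ⟨p, hp, hpφ⟩ := (hS φ).1 hφ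
  obtain ⟨q, hq, hqψ⟩ := (hT ψ).1 hψ
  obtain ⟨χ, hχ⟩ := exists_forall_evalGL_ne_zero (n := n) Finset.univ (fun b => cond b p q)
    (by rintro (_ | _) -; exacts [⟨ψ, hqψ⟩, ⟨φ, hpφ⟩])
  exact ⟨χ, (hS χ).2 ⟨p, hp, hχ true (Finset.mem_univ _)⟩,
    (hT χ).2 ⟨q, hq, hχ false (Finset.mem_univ _)⟩⟩

/-- A polynomial in the entries of `γ⁻¹` becomes a polynomial in the entries of `γ` when it is
multiplied by a suitable power of the determinant. -/
theorem exists_evalGL_eq_det_pow_mul (p : MvPolynomial (Fin n × Fin n) K) :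
    ∃ (q : MvPolynomial (Fin n × Fin n) K) (N : ℕ), ∀ γ : GL (Fin n) K,
      evalGL γ q = γ.val.det ^ N * evalGL γ⁻¹ p := by
  have hdet : ∀ γ : GL (Fin n) K,
      evalGL γ (Matrix.mvPolynomialX (Fin n) (Fin n) K).det = γ.val.det := by
    intro γ
    rw [RingHom.map_det, evalGL_mvPolynomialX]
  induction p using MvPolynomial.induction_on with
  | C a => exact ⟨MvPolynomial.C a, 0, fun γ => by rw [evalGL_C, evalGL_C, pow_zero, one_mul]⟩
  | add p₁ p₂ h₁ h₂ =>
    obtain ⟨q₁, N₁, h₁⟩ := h₁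
    obtain ⟨q₂, N₂, h₂⟩ := h₂
    refine ⟨q₁ * (Matrix.mvPolynomialX (Fin n) (Fin n) K).det ^ N₂ +
      q₂ * (Matrix.mvPolynomialX (Fin n) (Fin n) K).det ^ N₁, N₁ + N₂, fun γ => ?_⟩
    rw [map_add, map_mul, map_mul, map_pow, map_pow, hdet, h₁, h₂, map_add]
    ring
  | mul_X p ij h =>
    obtain ⟨q, N, h⟩ := h
    obtain ⟨i, j⟩ := ij
    refine ⟨q * (Matrix.mvPolynomialX (Fin n) (Fin n) K).adjugate i j, N + 1, fun γ => ?_⟩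
    have hadj : evalGL γ ((Matrix.mvPolynomialX (Fin n) (Fin n) K).adjugate i j) =
        γ.val.adjugate i j := by
      rw [← evalGL_mvPolynomialX γ, ← RingHom.map_adjugate]
      rfl
    have hne : γ.val.det ≠ 0 := (Matrix.isUnit_iff_isUnit_det _ |>.1 γ.isUnit).ne_zero
    rw [map_mul, map_mul, h, hadj, evalGL_X, Matrix.coe_units_inv, Matrix.inv_def,
      Matrix.smul_apply, Ring.inverse_eq_inv', smul_eq_mul]
    field_simp
    ring

theorem IsZariskiOpen.preimage_inv {U : Set (GL (Fin n) K)} (hU : IsZariskiOpen U) :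
    IsZariskiOpen {γ | γ⁻¹ ∈ U} := by
  obtain ⟨S, hS⟩ := hU
  choose q N hq using exists_evalGL_eq_det_pow_mul (K := K) (n := n)
  refine ⟨q '' S, fun γ => ?_⟩
  have hne : γ.val.det ≠ 0 := (Matrix.isUnit_iff_isUnit_det _ |>.1 γ.isUnit).ne_zero
  rw [Set.mem_ofPred_eq, hS, Set.exists_mem_image]
  refine exists_congr fun p => and_congr_right fun _ => ?_
  change evalGL γ⁻¹ p ≠ 0 ↔ evalGL γ (q p) ≠ 0
  rw [hq, mul_ne_zero_iff, and_iff_right (pow_ne_zero _ hne)]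

/-- The rank of a linear map that depends polynomially on `φ ∈ GL_n(K)` is lower semicontinuous. -/
theorem exists_evalGL_ne_zero_finrank_range_le {V W : Type*} [AddCommGroup V] [Module K V]
    [AddCommGroup W] [Module K W] [Module.Finite K W] (T : GL (Fin n) K → V →ₗ[K] W)
    (hT : ∀ (x : V) (l : W →ₗ[K] K), IsPolynomialFun fun φ => l (T φ x)) (φ₀ : GL (Fin n) K) :
    ∃ p, evalGL φ₀ p ≠ 0 ∧ ∀ φ, evalGL φ p ≠ 0 →
      Module.finrank K (LinearMap.range (T φ₀)) ≤ Module.finrank K (LinearMap.range (T φ)) := by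
  let b := Module.finBasis K (LinearMap.range (T φ₀))
  choose x hx using fun i => (b i).2
  obtain ⟨g, hg⟩ := LinearMap.exists_leftInverse_of_injective
    (LinearMap.range (T φ₀)).subtype (Submodule.ker_subtype _)
  -- the functionals `b.coord j ∘ g` on `W` are dual to the basis `b` of the range of `T φ₀`
  choose P hP using fun i j => hT (x i) (b.coord j ∘ₗ g)
  have hdet : ∀ φ, evalGL φ (Matrix.of P).det =
      (Matrix.of fun i j => b.coord j (g (T φ (x i)))).det := by
    intro φ
    rw [RingHom.map_det]
    congr 1
    ext i j
    exact (hP i j φ).symm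
  refine ⟨(Matrix.of P).det, ?_, fun φ hφ => ?_⟩
  · rw [hdet]
    have h1 : (Matrix.of fun i j => b.coord j (g (T φ₀ (x i)))) = 1 := by
      ext i j
      have := LinearMap.congr_fun hg (b i)
      simp only [LinearMap.comp_apply, Submodule.subtype_apply, LinearMap.id_apply] at this
      simp [hx, this, Matrix.one_apply, Finsupp.single_apply]
    rw [h1, Matrix.det_one]
    exact one_ne_zero
  · rw [hdet] at hφ
    have hrows := Matrix.linearIndependent_rows_of_det_ne_zero hφ
    have hli : LinearIndependent K (fun i => (⟨T φ (x i), x i, rfl⟩ : LinearMap.range (T φ))) :=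
      LinearIndependent.of_comp
        ((LinearMap.pi fun j => b.coord j ∘ₗ g) ∘ₗ (LinearMap.range (T φ)).subtype) hrows
    simpa using hli.fintype_card_le_finrank

end Zariski

/-! ### The generic initial ideal -/

section Generic

variable {K : Type*} [Field K] {n : ℕ}

theorem isPolynomialFun_action (x : E K n) (l : E K n →ₗ[K] K) :
    IsPolynomialFun fun φ : GL (Fin n) K => l (action φ x) := by
  induction x using ExteriorAlgebra.induction generalizing l with
  | algebraMap r => simpa using isPolynomialFun_const (l (algebraMap K (E K n) r))
  | ι v =>
    have h : ∀ φ : GL (Fin n) K, l (action φ (ExteriorAlgebra.ι K v)) =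
        ∑ i, (∑ j, φ.val i j * v j) * l (gen K i) := by
      intro φ
      rw [action_ι, ι_eq_sum_gen, map_sum]
      simp only [map_smul, smul_eq_mul]
      rfl
    simp only [h]
    exact isPolynomialFun_sum _ fun i _ => (isPolynomialFun_sum _ fun j _ =>
      (isPolynomialFun_apply i j).mul (isPolynomialFun_const _)).mul (isPolynomialFun_const _)
  | mul a b ha hb =>
    have h : ∀ φ : GL (Fin n) K, l (action φ (a * b)) = ∑ A, ∑ B,
        ((monomialBasis K n).coord A (action φ a) * (monomialBasis K n).coord B (action φ b)) *
          l (monomialBasis K n A * monomialBasis K n B) := by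
      intro φ
      rw [map_mul]
      conv_lhs => rw [← (monomialBasis K n).sum_repr (action φ a),
        ← (monomialBasis K n).sum_repr (action φ b)]
      simp only [Finset.sum_mul_sum, map_sum, smul_mul_smul_comm, map_smul, smul_eq_mul,
        Module.Basis.coord_apply]
    simp only [h]
    exact isPolynomialFun_sum _ fun A _ => isPolynomialFun_sum _ fun B _ =>
      ((ha _).mul (hb _)).mul (isPolynomialFun_const _)
  | add a b ha hb =>
    simp only [map_add]
    exact (ha l).add (hb l)

/-- The coordinates of an element of `E` at the monomials in `S`. -/
def coordProj (K : Type*) [Field K] {n : ℕ} (S : Set (Finset (Fin n))) :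
    E K n →ₗ[K] (S → K) :=
  LinearMap.pi fun A => (monomialBasis K n).coord A.1

theorem mem_ker_coordProj {S : Set (Finset (Fin n))} {f : E K n} :
    f ∈ LinearMap.ker (coordProj K S) ↔ ∀ A ∈ S, (monomialBasis K n).repr f A = 0 := by
  rw [LinearMap.mem_ker, funext_iff, Subtype.forall]
  rfl

/-- `e_A` is an initial monomial of `V` iff the coordinate at `e_A` increases the rank of the
projection of `V` to the coordinates at the monomials larger than `e_A`. -/
theorem mem_initSet_iff {V : Submodule K (E K n)} {A : Finset (Fin n)} :
    A ∈ initSet V ↔ Module.finrank K (V.map (coordProj K {B | RlexLT A B})) ≠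
      Module.finrank K (V.map (coordProj K (insert A {B | RlexLT A B}))) := by
  have e1 := finrank_map_add_finrank_ker_inf (coordProj K {B | RlexLT A B}) V
  have e2 := finrank_map_add_finrank_ker_inf (coordProj K (insert A {B | RlexLT A B})) V
  have hle : LinearMap.ker (coordProj K (insert A {B | RlexLT A B})) ⊓ V ≤
      LinearMap.ker (coordProj K {B | RlexLT A B}) ⊓ V := by
    rintro f ⟨hf, hV⟩
    exact ⟨mem_ker_coordProj.2 fun B hB => mem_ker_coordProj.1 hf B (Or.inr hB), hV⟩
  constructor
  · rintro ⟨f, hf, hA⟩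
    have hlt := Submodule.finrank_lt_finrank_of_lt (lt_of_le_of_ne hle fun heq => by
      have hf' : f ∈ LinearMap.ker (coordProj K {B | RlexLT A B}) ⊓ V :=
        ⟨mem_ker_coordProj.2 fun B hB => hA.repr_eq_zero hB, hf⟩
      rw [← heq] at hf'
      exact hA.1 (mem_ker_coordProj.1 hf'.1 A (Or.inl rfl)))
    omega
  · intro hne
    by_contra hA
    have hge : LinearMap.ker (coordProj K {B | RlexLT A B}) ⊓ V ≤
        LinearMap.ker (coordProj K (insert A {B | RlexLT A B})) ⊓ V := by
      rintro f ⟨hf, hV⟩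
      replace hf := mem_ker_coordProj.1 hf
      refine ⟨mem_ker_coordProj.2 ?_, hV⟩
      rintro B (rfl | hB)
      · by_contra hB
        exact hA ⟨f, hV, hB, fun C hC hCB => (RlexLT.trichotomous hCB).resolve_right
          fun hlt => hC (hf C hlt)⟩
      · exact hf B hB
    rw [le_antisymm hle hge] at e2
    omega

/-- On a nonempty Zariski-open set, the ranks of all coordinate projections of `φ(J)` are maximal,
hence constant, and they determine the initial monomials of `φ(J)`. -/
theorem exists_isGenericInitialIdeal [Infinite K] (J : Ideal (E K n)) :
    ∃ I, IsGenericInitialIdeal J I := by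
  classical
  let R (S : Set (Finset (Fin n))) (φ : GL (Fin n) K) :
      J.restrictScalars K →ₗ[K] (S → K) :=
    coordProj K S ∘ₗ (action φ).toLinearMap ∘ₗ (J.restrictScalars K).subtype
  have hR : ∀ S φ, Module.finrank K (LinearMap.range (R S φ)) =
      Module.finrank K (((J.map (action φ)).restrictScalars K).map (coordProj K S)) := by
    intro S φ
    have hmap : (J.restrictScalars K).map (action φ).toLinearMap =
        (J.map (action φ)).restrictScalars K := by
      ext x
      exact (mem_map_action_iff (φ := φ) (J := J) (x := x)).symm
    rw [LinearMap.range_comp, LinearMap.range_comp, Submodule.range_subtype, hmap]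
  have hmax : ∀ S, ∃ φ₀, ∀ φ,
      Module.finrank K (LinearMap.range (R S φ)) ≤
        Module.finrank K (LinearMap.range (R S φ₀)) := by
    intro S
    have hb : BddAbove (Set.range fun φ => Module.finrank K (LinearMap.range (R S φ))) := by
      refine ⟨Module.finrank K (J.restrictScalars K), ?_⟩
      rintro _ ⟨φ, rfl⟩
      exact LinearMap.finrank_range_le _
    obtain ⟨φ₀, h⟩ := Nat.sSup_mem (Set.range_nonempty _) hb
    exact ⟨φ₀, fun φ => (le_csSup hb ⟨φ, rfl⟩).trans h.ge⟩
  choose φ₀ hφ₀ using hmax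
  have hpoly : ∀ S, ∃ p, evalGL (φ₀ S) p ≠ 0 ∧ ∀ φ, evalGL φ p ≠ 0 →
      Module.finrank K (LinearMap.range (R S (φ₀ S))) ≤
        Module.finrank K (LinearMap.range (R S φ)) := fun S =>
    exists_evalGL_ne_zero_finrank_range_le (R S)
      (fun x l => isPolynomialFun_action x.1 (l ∘ₗ coordProj K S)) (φ₀ S)
  choose p hp hp' using hpoly
  obtain ⟨ψ, hψ⟩ := exists_forall_evalGL_ne_zero Finset.univ p fun S _ => ⟨φ₀ S, hp S⟩
  refine ⟨initialIdeal (J.map (action ψ)), {φ | evalGL φ (∏ S, p S) ≠ 0},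
    ⟨{∏ S, p S}, fun γ => by simp [evalGL]⟩, ⟨ψ, ?_⟩, fun φ hφ => ?_⟩
  · rw [Set.mem_ofPred_eq, map_prod, Finset.prod_ne_zero_iff]
    exact hψ
  · rw [Set.mem_ofPred_eq, map_prod, Finset.prod_ne_zero_iff] at hφ
    have hrank : ∀ S, Module.finrank K
        (((J.map (action φ)).restrictScalars K).map (coordProj K S)) =
        Module.finrank K (((J.map (action ψ)).restrictScalars K).map (coordProj K S)) := by
      intro S
      rw [← hR, ← hR]
      exact le_antisymm ((hφ₀ S φ).trans (hp' S ψ (hψ S (Finset.mem_univ S))))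
        ((hφ₀ S ψ).trans (hp' S φ (hφ S (Finset.mem_univ S))))
    rw [initialIdeal_eq_span, initialIdeal_eq_span]
    congr 2
    ext A
    rw [mem_initSet_iff, mem_initSet_iff, hrank, hrank]

theorem IsGenericInitialIdeal.unique [Infinite K] {J I I' : Ideal (E K n)}
    (h : IsGenericInitialIdeal J I) (h' : IsGenericInitialIdeal J I') : I = I' := by
  obtain ⟨U, hU, hne, hI⟩ := h
  obtain ⟨U', hU', hne', hI'⟩ := h'
  obtain ⟨φ, hφ, hφ'⟩ := hU.inter_nonempty hU' hne hne'
  rw [← hI φ hφ, hI' φ hφ']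

theorem isGenericInitialIdeal_gin [Infinite K] (J : Ideal (E K n)) :
    IsGenericInitialIdeal J (gin J) := by
  have h := exists_isGenericInitialIdeal J
  rw [gin, dif_pos h]
  exact h.choose_spec

end Generic
end

end ExtAnn

theorem theorem3p3 {K : Type*} [Field K] [Infinite K] {n : ℕ} (J : Ideal (ExtAnn.E K n))
    (hJ : J.IsHomogeneous (fun d : ℕ => ⋀[K]^d (Fin n → K))) :
    (∃! I : Ideal (ExtAnn.E K n), ExtAnn.IsGenericInitialIdeal J I) ∧
    ∃ U : Set (GL (Fin n) K), ExtAnn.IsZariskiOpen U ∧ U.Nonempty ∧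
      ∀ γ ∈ U, ∀ (i : Fin n) (j : ℤ),
        ExtAnn.alpha (ExtAnn.transformedSeq γ) J i j =
          ExtAnn.alpha (ExtAnn.gen K) (ExtAnn.gin J) i j := by
  have hgin := ExtAnn.isGenericInitialIdeal_gin J
  refine ⟨⟨_, hgin, fun I hI => hI.unique hgin⟩, ?_⟩
  obtain ⟨U, hU, ⟨φ, hφ⟩, h⟩ := hgin
  refine ⟨{γ | γ⁻¹ ∈ U}, hU.preimage_inv, ⟨φ⁻¹, by simpa using hφ⟩, fun γ hγ i j => ?_⟩
  rw [ExtAnn.alpha_transformedSeq hJ, ← h γ⁻¹ hγ,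
    ExtAnn.alpha_gen_initialIdeal (ExtAnn.isHomogeneous_map_action hJ γ⁻¹)]
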